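/- Conventions. A Euclidean mm-space in $\mathbb{R}^n$ is a subset $X\subset\mathbb{R}^n$ which is a Polish (i.e. separable and completely metrizable) space in the subspace topology, equipped with the restriction $d_X$ of the Euclidean distance and with a fully supported Borel probability measure $\mu_X$. A measurable map $\phi:X\to Y$ is measure-preserving if $\phi_\#\mu_X=\mu_Y$; $\mathcal{T}(\mu_X,\mu_Y)$ is the set of such maps. All distances take values in $[0,\infty]$, the infimum over the empty set is $\infty$, and $0\cdot\infty=0$. For $p\in[1,\infty)$ and Borel probability measures $\mu,\nu$ on a metric space $(Z,d_Z)$, the Monge $p$-distance is $$\mathrm{M}^Z_p(\mu,\nu)=\inf_{\phi\in\mathcal{T}(\mu,\nu)}\Big(\int_Z d_Z(z,\phi(z))^p\,\mu(dz)\Big)^{1/p},$$ and the embedding form of the Gromov-Monge $p$-distance is $$\mathrm{GM}^{\mathrm{em}}_p(\mathcal{X},\mathcal{Y})=\inf_{Z,\phi_X,\phi_Y}\mathrm{M}^Z_p\big((\phi_X)_\#\mu_X,(\phi_Y)_\#\mu_Y\big),$$ the infimum being over all metric spaces $Z$ and all isometric (distance-preserving) embeddings $\phi_X:X\to Z$,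 $\phi_Y:Y\to Z$. For Euclidean mm-spaces $\mathcal{X},\mathcal{Y}$ in the same $\mathbb{R}^n$, the isometry-invariant Monge $p$-distance is $$\mathrm{M}^{\mathrm{iso}}_p(\mathcal{X},\mathcal{Y})=\inf_{T\in E(n)}\Big(\inf_{\phi\in\mathcal{T}(\mu_X,\mu_Y)}\int_X\|T(x)-\phi(x)\|^p\,\mu_X(dx)\Big)^{1/p},$$ where $E(n)$ is the group of isometries of $\mathbb{R}^n$. Theorem. For every $n$ there is a finite constant $c_n\ge 0$, depending only on $n$, such that for all Euclidean mm-spaces $\mathcal{X}$ and $\mathcal{Y}$ in the same ambient space $\mathbb{R}^n$ and all $p\in[1,\infty)$, with $M=\max\{\mathrm{diam}(X),\mathrm{diam}(Y)\}\in[0,\infty]$, $$\mathrm{GM}^{\mathrm{em}}_p(\mathcal{X},\mathcal{Y})\le \mathrm{M}^{\mathrm{iso}}_p(\mathcal{X},\mathcal{Y})\le M^{3/4}\cdot c_n\cdot\big(\mathrm{GM}^{\mathrm{em}}_p(\mathcal{X},\mathcal{Y})\big)^{1/4}.$$ -/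

import Mathlib

open MeasureTheory
open scoped ENNReal NNReal

universe u v

/-- The Monge `p`-distance (`p` a finite exponent) between two Borel measures on a metric space
`Z`: the infimum, over all measure-preserving maps `φ : (Z, μ) → (Z, ν)`, of the `L^p`-norm of the
distance function with respect to the coupling `(id, φ)_# μ` induced by `φ`, written as an
integral over `Z`. It is `∞` if there is no measure-preserving map. -/
noncomputable def mongeDist {Z : Type u} [MetricSpace Z] [MeasurableSpace Z]
    (p : ℝ) (μ ν : Measure Z) : ℝ≥0∞ :=
  ⨅ (φ : Z → Z) (_ : MeasurePreserving φ μ ν), (∫⁻ z, edist z (φ z) ^ p ∂μ) ^ (1 / p)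

/-- The embedding formulation `GM^em_p` of the Gromov-Monge distance between metric measure spaces
`(X, μ)` and `(Y, ν)`: the infimum of the Monge `p`-distances of the push-forwards of `μ` and `ν`
under isometric embeddings of `X` and `Y` in a common metric space `Z` with its Borel σ-algebra.
The universe of `Z` is large enough to hold the union of the two images, to which `Z` can be
restricted. -/
noncomputable def gromovMongeEmb {X : Type u} {Y : Type v}
    [MetricSpace X] [MeasurableSpace X] [MetricSpace Y] [MeasurableSpace Y]
    (p : ℝ) (μ : Measure X) (ν : Measure Y) : ℝ≥0∞ :=
  ⨅ (Z : Type (max u v)) (_ : MetricSpace Z) (_ : MeasurableSpace Z) (_ : BorelSpace Z)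
    (f : X → Z) (_ : Isometry f) (g : Y → Z) (_ : Isometry g),
    mongeDist p (μ.map f) (ν.map g)

/-- The isometry-invariant Monge `p`-distance between measures on subsets `X`, `Y` of the same
Euclidean space `ℝⁿ`: `T` runs over all isometries of `ℝⁿ` onto itself, and `φ` over all
measure-preserving maps from `(X, μ)` to `(Y, ν)`. -/
noncomputable def isoMongeDist {n : ℕ} {X Y : Set (EuclideanSpace ℝ (Fin n))}
    (p : ℝ) (μ : Measure X) (ν : Measure Y) : ℝ≥0∞ :=
  ⨅ T : EuclideanSpace ℝ (Fin n) ≃ᵢ EuclideanSpace ℝ (Fin n),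
    (⨅ (φ : X → Y) (_ : MeasurePreserving φ μ ν),
      ∫⁻ x : X, ‖T (x : EuclideanSpace ℝ (Fin n)) - (φ x : EuclideanSpace ℝ (Fin n))‖ₑ ^ p ∂μ)
        ^ (1 / p)

/-! The left inequality takes `Z` to be the ambient space itself, with `X` embedded by `T` and `Y`
by inclusion.

For the right one, a common metric space `Z` yields a measure-preserving `ψ : X → Y` and a
displacement `δ` with small `L^p`-norm, such that `ψ` distorts distances by at most `δ x + δ x'`
(`exists_measurePreserving_of_gromovMongeEmb_lt`). By Markov, `δ ≤ t` off a small set. On the good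
points `ψ` is a near-isometry, and `exists_affineIsometry_of_nearIsometry` replaces it by a rigid
motion up to a multiple of `√(t * m)`. That rests on a Gram–Schmidt induction: nearly equal Gram
matrices come from families that are nearly congruent. The choice `t = √(e * m)` makes the error `m
^ (3/4) * e ^ (1/4)`, and the exceptional points cost no more in order.

If the embedding distance is `0`, the bound must be `0` even for infinite diameter. Rigid motions
close in measure to maps `ψ k` then subconverge, and the limit carries `μ` to `ν`. -/

/-- One step of the Gram–Schmidt comparison at the level of inner products: `P`, `Q` are the squared
norms of the pivots, `p`, `q` the inner products with the pivots. -/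
lemma abs_schur_sub_le {P Q p q p' q' η : ℝ} (hη : 0 ≤ η) (hP : 4 * η < P) (hPQ : |P - Q| ≤ η)
    (hp : |p| ≤ 2 * P) (hp' : |p'| ≤ 2 * P) (hpq : |p - q| ≤ η) (hpq' : |p' - q'| ≤ η) :
    |p * p' / P - q * q' / Q| ≤ 24 * η := by
  have hP0 : 0 < P := by linarith
  have hQP : 3 / 4 * P ≤ Q := by linarith [(abs_le.1 hPQ).2]
  have hQ0 : 0 < Q := by linarith
  have hq : |q| ≤ 3 * P := by
    have := abs_sub_abs_le_abs_sub q p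
    rw [abs_sub_comm] at this; linarith
  have hq' : |q'| ≤ 3 * P := by
    have := abs_sub_abs_le_abs_sub q' p'
    rw [abs_sub_comm] at this; linarith
  have key : p * p' / P - q * q' / Q
      = (p * (p' - q') + (p - q) * q') / P + q * q' * (Q - P) / (P * Q) := by
    field_simp; ring
  have h1 : |(p * (p' - q') + (p - q) * q') / P| ≤ 5 * η := by
    rw [abs_div, abs_of_pos hP0, div_le_iff₀ hP0]
    calc _ ≤ |p| * |p' - q'| + |p - q| * |q'| := by
          simpa [abs_mul] using abs_add_le (p * (p' - q')) ((p - q) * q')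
      _ ≤ (2 * P) * η + η * (3 * P) := by gcongr
      _ = _ := by ring
  have h2 : |q * q' * (Q - P) / (P * Q)| ≤ 12 * η := by
    rw [abs_div, abs_of_pos (mul_pos hP0 hQ0), div_le_iff₀ (mul_pos hP0 hQ0), abs_mul, abs_mul,
      abs_sub_comm]
    calc _ ≤ (3 * P) * (3 * P) * η := by gcongr
      _ = 12 * η * (P * (3 / 4 * P)) := by ring
      _ ≤ _ := by gcongr
  rw [key]
  linarith [abs_add_le ((p * (p' - q') + (p - q) * q') / P) (q * q' * (Q - P) / (P * Q))]

/-- Comparison of the coordinates along the normalized pivots of norms `a` and `b`. -/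
lemma abs_div_sub_div_le {a b p q η : ℝ} (hη : 0 ≤ η) (ha : 2 * √η < a) (hb : 0 ≤ b)
    (hab : |a ^ 2 - b ^ 2| ≤ η) (hp : |p| ≤ 2 * a ^ 2) (hpq : |p - q| ≤ η) :
    |p / a - q / b| ≤ 6 * √η := by
  have hs := Real.sqrt_nonneg η
  have hss := Real.sq_sqrt hη
  have ha0 : 0 < a := by linarith
  have hba : a / 2 ≤ b := by
    have := (abs_le.1 hab).2
    nlinarith
  have hb0 : 0 < b := by linarith
  have hq : |q| ≤ 3 * a ^ 2 := by
    have := abs_sub_abs_le_abs_sub q p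
    rw [abs_sub_comm] at this; nlinarith
  have key : p / a - q / b = (p - q) / a - q * (a ^ 2 - b ^ 2) / (a * b * (a + b)) := by
    field_simp; ring
  have h1 : |(p - q) / a| ≤ √η := by
    rw [abs_div, abs_of_pos ha0, div_le_iff₀ ha0]
    nlinarith
  have h2 : |q * (a ^ 2 - b ^ 2) / (a * b * (a + b))| ≤ 5 * √η := by
    have hpos : 0 < a * b * (a + b) := by positivity
    rw [abs_div, abs_of_pos hpos, div_le_iff₀ hpos, abs_mul]
    calc _ ≤ (3 * a ^ 2) * η := by gcongr
      _ = 3 * a ^ 2 * √η * √η := by rw [mul_assoc _ (√η), Real.mul_self_sqrt hη]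
      _ ≤ 3 * a ^ 2 * √η * (a / 2) := by gcongr; linarith
      _ ≤ 5 * √η * (a * (a / 2) * (a + a / 2)) := by
          have : 0 ≤ a ^ 3 * √η := by positivity
          nlinarith
      _ ≤ _ := by gcongr
  rw [key]
  linarith [abs_sub ((p - q) / a) (q * (a ^ 2 - b ^ 2) / (a * b * (a + b)))]

/-! ### Rigidity: nearly equal Gram matrices and near-isometries. -/

section Gram

variable {V : Type*} [NormedAddCommGroup V] [InnerProductSpace ℝ V]

open scoped RealInnerProductSpace

lemma inner_sub_proj_sub_proj {u : V} (hu : ‖u‖ = 1) (x y : V) :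
    ⟪x - ⟪u, x⟫ • u, y - ⟪u, y⟫ • u⟫ = ⟪x, y⟫ - ⟪u, x⟫ * ⟪u, y⟫ := by
  have : ⟪u, u⟫ = 1 := by rw [real_inner_self_eq_norm_sq, hu]; norm_num
  simp only [inner_sub_left, inner_sub_right, inner_smul_left, inner_smul_right, this,
    real_inner_comm u x]
  simp

variable [FiniteDimensional ℝ V]

/-- Two bounded families of vectors of a subspace `S` whose Gram matrices are uniformly `η`-close are
matched, up to an error of order `√η`, by a linear isometry which is the identity on `Sᗮ`. -/
theorem exists_linearIsometryEquiv_of_gram (k : ℕ) :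
    ∃ C : ℝ, 0 ≤ C ∧ ∀ (ι : Type) (S : Submodule ℝ V), Module.finrank ℝ S ≤ k →
      ∀ (x y : ι → V) (η B : ℝ), 0 ≤ η → (∀ a, x a ∈ S) → (∀ a, y a ∈ S) → (∀ a, ‖x a‖ ≤ B) →
      (∀ a b, |⟪x a, x b⟫ - ⟪y a, y b⟫| ≤ η) →
      ∃ U : V ≃ₗᵢ[ℝ] V, (∀ s ∈ Sᗮ, U s = s) ∧ ∀ a, ‖U (x a) - y a‖ ≤ C * √η := by
  induction k with
  | zero =>
    refine ⟨0, le_rfl, fun ι S hS x y η B hη hx hy hB h => ⟨.refl ℝ V, fun _ _ => rfl, fun a => ?_⟩⟩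
    have hS : S = ⊥ := Submodule.finrank_eq_zero.1 (by omega)
    subst hS
    simp [(Submodule.mem_bot ℝ).1 (hx a), (Submodule.mem_bot ℝ).1 (hy a)]
  | succ k ih =>
    obtain ⟨C, hC, ih⟩ := ih
    -- The projected families have Gram defect `25 * η`, whence `C * √(25 * η)`; the coordinate
    -- along the pivot adds `6 * √η`.
    refine ⟨5 * C + 6, by positivity, fun ι S hS x y η B hη hx hy hB h => ?_⟩
    have hs := Real.sqrt_nonneg η
    have hss := Real.sq_sqrt hη
    by_cases hsmall : ∀ a, ‖x a‖ ≤ 2 * √η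
    · refine ⟨.refl ℝ V, fun _ _ => rfl, fun a => ?_⟩
      have h1 := hsmall a
      have h2 : ‖y a‖ ≤ 3 * √η := by
        have := (abs_le.1 (h a a)).1
        rw [real_inner_self_eq_norm_sq, real_inner_self_eq_norm_sq] at this
        have h3 := norm_nonneg (x a)
        apply le_of_sq_le_sq _ (by positivity)
        nlinarith
      have h3 := norm_sub_le (x a) (y a)
      have h4 : 0 ≤ C * √η := by positivity
      simp only [LinearIsometryEquiv.coe_refl, id]
      nlinarith
    · push Not at hsmall
      obtain ⟨a₁, ha₁⟩ := hsmall
      have hbdd : BddAbove (Set.range fun a => ‖x a‖) := ⟨B, by rintro _ ⟨a, rfl⟩; exact hB a⟩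
      have hle : ∀ a, ‖x a‖ ≤ ⨆ a, ‖x a‖ := fun a => le_ciSup hbdd a
      -- The supremum may not be attained. A pivot above half of it keeps all inner products with
      -- the pivot at most twice its squared norm; a pivot above `2 * √η` keeps the divisions
      -- stable.
      have hmax : max ((⨆ a, ‖x a‖) / 2) (2 * √η) < ⨆ a, ‖x a‖ := by
        have := hle a₁
        apply max_lt <;> linarith
      have : Nonempty ι := ⟨a₁⟩
      obtain ⟨o, ho⟩ := exists_lt_of_lt_ciSup hmax
      obtain ⟨ho1, ho2⟩ := max_lt_iff.1 ho
      have hx2 : ∀ a, ‖x a‖ ≤ 2 * ‖x o‖ := fun a => by linarith [hle a]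
      have hPQ : |‖x o‖ ^ 2 - ‖y o‖ ^ 2| ≤ η := by
        simpa [real_inner_self_eq_norm_sq] using h o o
      have hxo : 0 < ‖x o‖ := by linarith
      have hyo : 0 < ‖y o‖ := by
        have := (abs_le.1 hPQ).2
        rcases (norm_nonneg (y o)).eq_or_lt with h0 | h0
        · rw [← h0] at this; nlinarith
        · exact h0
      set u := ‖x o‖⁻¹ • x o with hu
      set v := ‖y o‖⁻¹ • y o with hv
      have hu1 : ‖u‖ = 1 := by rw [hu, norm_smul, norm_inv, norm_norm]; field_simp
      have hv1 : ‖v‖ = 1 := by rw [hv, norm_smul, norm_inv, norm_norm]; field_simp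
      have huS : u ∈ S := S.smul_mem _ (hx o)
      have hvS : v ∈ S := S.smul_mem _ (hy o)
      -- This reflection takes one normalized pivot to the other and moves nothing outside `S`, as
      -- `u - v ∈ S`. The remaining discrepancy lies in `S'`, of smaller dimension, and along `v`.
      let R : V ≃ₗᵢ[ℝ] V := (ℝ ∙ (u - v))ᗮ.reflection
      have hRu : R u = v := Submodule.reflection_sub (by rw [hu1, hv1])
      have hRfix : ∀ s ∈ Sᗮ, R s = s := fun s hs => by
        apply Submodule.reflection_mem_subspace_eq_self
        exact (Submodule.orthogonal_le
          ((Submodule.span_singleton_le_iff_mem _ _).2 (S.sub_mem huS hvS))) hs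
      have hRS : ∀ s ∈ S, R s ∈ S := fun s hs => by
        rw [← Submodule.orthogonal_orthogonal S, Submodule.mem_orthogonal]
        intro w hw
        rw [← hRfix w hw, LinearIsometryEquiv.inner_map_map]
        exact Submodule.inner_left_of_mem_orthogonal hs hw
      let S' : Submodule ℝ V := S ⊓ (ℝ ∙ v)ᗮ
      have hS'lt : S' < S := by
        refine lt_of_le_of_ne inf_le_left fun hEq => ?_
        have : v ∈ S' := hEq ▸ hvS
        have := Submodule.mem_orthogonal_singleton_iff_inner_right.1 this.2
        rw [real_inner_self_eq_norm_sq, hv1] at this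
        norm_num at this
      have hS' : Module.finrank ℝ S' ≤ k := by
        have := Submodule.finrank_lt_finrank_of_lt hS'lt
        omega
      have hmem : ∀ w ∈ S, w - ⟪v, w⟫ • v ∈ S' := fun w hw =>
        ⟨S.sub_mem hw (S.smul_mem _ hvS), by
          rw [SetLike.mem_coe, Submodule.mem_orthogonal_singleton_iff_inner_right, inner_sub_right,
            inner_smul_right, real_inner_self_eq_norm_sq, hv1]; ring⟩
      have hvx : ∀ a, ⟪v, R (x a)⟫ = ⟪x a, x o⟫ / ‖x o‖ := fun a => by
        rw [← hRu, LinearIsometryEquiv.inner_map_map, hu, inner_smul_left, real_inner_comm]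
        simp; ring
      have hvy : ∀ a, ⟪v, y a⟫ = ⟪y a, y o⟫ / ‖y o‖ := fun a => by
        rw [hv, inner_smul_left, real_inner_comm]; simp; ring
      have hp : ∀ a, |⟪x a, x o⟫| ≤ 2 * ‖x o‖ ^ 2 := fun a => by
        calc _ ≤ ‖x a‖ * ‖x o‖ := abs_real_inner_le_norm _ _
          _ ≤ (2 * ‖x o‖) * ‖x o‖ := by gcongr; exact hx2 a
          _ = _ := by ring
      -- The defect is `η` from the original inner products plus `24 * η` from the projection terms.
      obtain ⟨U, hUfix, hU⟩ := ih ι S' hS' (fun a => R (x a) - ⟪v, R (x a)⟫ • v)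
        (fun a => y a - ⟪v, y a⟫ • v) (25 * η) (B + B) (by positivity)
        (fun a => hmem _ (hRS _ (hx a))) (fun a => hmem _ (hy a))
        (fun a => by
          refine (norm_sub_le _ _).trans ?_
          have h1 : ‖R (x a)‖ ≤ B := by simpa using hB a
          have h2 := norm_inner_le_norm (𝕜 := ℝ) v (R (x a))
          rw [hv1] at h2
          rw [norm_smul, hv1]; linarith)
        (fun a b => by
          rw [inner_sub_proj_sub_proj hv1, inner_sub_proj_sub_proj hv1,
            LinearIsometryEquiv.inner_map_map, hvx, hvx, hvy, hvy]
          have h1 := abs_schur_sub_le hη (by nlinarith) hPQ (hp a) (hp b) (h a o) (h b o)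
          have h2 := h a b
          have e1 : ⟪x a, x o⟫ / ‖x o‖ * (⟪x b, x o⟫ / ‖x o‖)
            = ⟪x a, x o⟫ * ⟪x b, x o⟫ / ‖x o‖ ^ 2 := by field_simp
          have e2 : ⟪y a, y o⟫ / ‖y o‖ * (⟪y b, y o⟫ / ‖y o‖)
            = ⟪y a, y o⟫ * ⟪y b, y o⟫ / ‖y o‖ ^ 2 := by field_simp
          rw [e1, e2]
          rw [abs_le] at h1 h2 ⊢
          constructor <;> linarith [h1.1, h1.2, h2.1, h2.2])
      -- Since `v ⊥ S'`, the inductive isometry preserves the alignment of the pivots; this is why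
      -- the induction demands the identity on `Sᗮ`.
      have hUv : U v = v := hUfix v (by
        rw [Submodule.mem_orthogonal]
        intro w hw
        rw [real_inner_comm]
        exact Submodule.mem_orthogonal_singleton_iff_inner_right.1 hw.2)
      refine ⟨R.trans U, fun s hs => ?_, fun a => ?_⟩
      · rw [LinearIsometryEquiv.trans_apply, hRfix s hs]
        exact hUfix s (Submodule.orthogonal_le hS'lt.le hs)
      · have h1 := hU a
        have h2 := abs_div_sub_div_le hη ho2 hyo.le hPQ (hp a) (h a o)
        rw [← hvx, ← hvy] at h2
        have e : (R.trans U) (x a) - y a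
            = (U (R (x a) - ⟪v, R (x a)⟫ • v) - (y a - ⟪v, y a⟫ • v))
              + (⟪v, R (x a)⟫ - ⟪v, y a⟫) • v := by
          simp only [LinearIsometryEquiv.trans_apply, map_sub, map_smul, hUv]
          module
        have h25 : √(25 * η) = 5 * √η := by
          rw [Real.sqrt_mul (by norm_num), show (25 : ℝ) = 5 ^ 2 by norm_num,
            Real.sqrt_sq (by norm_num)]
        rw [h25] at h1
        rw [e]
        refine (norm_add_le _ _).trans ?_
        rw [norm_smul, hv1, Real.norm_eq_abs]
        linarith

variable (V) in
/-- Near-isometries between bounded subsets of a Euclidean space are close to isometries: a family of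
pairs `(x a, y a)` whose mutual distances are at most `L` and differ by at most `2 * t` is matched,
up to an error of order `√(t * L)`, by an isometry of the whole space. -/
theorem exists_affineIsometry_of_nearIsometry :
    ∃ C : ℝ, 0 ≤ C ∧ ∀ (ι : Type) (x y : ι → V) (t L : ℝ), 0 ≤ t → 0 ≤ L →
      (∀ a b, dist (x a) (x b) ≤ L) → (∀ a b, dist (y a) (y b) ≤ L) →
      (∀ a b, |dist (x a) (x b) - dist (y a) (y b)| ≤ 2 * t) →
      ∃ (U : V ≃ₗᵢ[ℝ] V) (w : V), ∀ a, ‖U (x a) + w - y a‖ ≤ C * √(t * L) := by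
  obtain ⟨C, hC, H⟩ := exists_linearIsometryEquiv_of_gram (V := V) (Module.finrank ℝ V)
  -- Polarization at a base point involves three squared distances, each off by at most `4 * (t *
  -- L)`; half the sum is `6 * (t * L)`.
  refine ⟨C * √6, by positivity, fun ι x y t L ht hL hx hy h => ?_⟩
  rcases isEmpty_or_nonempty ι with hι | ⟨⟨o⟩⟩
  · exact ⟨.refl ℝ V, 0, fun a => hι.elim a⟩
  have hsq : ∀ a b, |dist (x a) (x b) ^ 2 - dist (y a) (y b) ^ 2| ≤ 4 * (t * L) := fun a b => by
    have e : dist (x a) (x b) ^ 2 - dist (y a) (y b) ^ 2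
      = (dist (x a) (x b) - dist (y a) (y b)) * (dist (x a) (x b) + dist (y a) (y b)) := by ring
    rw [e, abs_mul, abs_of_nonneg (a := dist (x a) (x b) + dist (y a) (y b)) (by positivity)]
    calc _ ≤ (2 * t) * (L + L) := by gcongr; exacts [h a b, hx a b, hy a b]
      _ = _ := by ring
  have hinner : ∀ a b o' : V, ⟪a - o', b - o'⟫
      = (dist a o' ^ 2 + dist b o' ^ 2 - dist a b ^ 2) / 2 := fun a b o' => by
    rw [real_inner_eq_norm_mul_self_add_norm_mul_self_sub_norm_sub_mul_self_div_two,
      sub_sub_sub_cancel_right, dist_eq_norm, dist_eq_norm, dist_eq_norm]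
    ring
  obtain ⟨U, -, hU⟩ := H ι ⊤ (Submodule.finrank_le _) (fun a => x a - x o) (fun a => y a - y o)
    (6 * (t * L)) L (by positivity) (fun _ => trivial) (fun _ => trivial)
    (fun a => by rw [← dist_eq_norm]; exact hx a o)
    (fun a b => by
      rw [hinner, hinner]
      have h1 := abs_le.1 (hsq a b)
      have h2 := abs_le.1 (hsq a o)
      have h3 := abs_le.1 (hsq b o)
      rw [abs_le]
      constructor <;> linarith [h1.1, h1.2, h2.1, h2.2, h3.1, h3.2])
  refine ⟨U, y o - U (x o), fun a => ?_⟩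
  have := hU a
  rw [Real.sqrt_mul (by norm_num)] at this
  have e : U (x a) + (y o - U (x o)) - y a = U (x a - x o) - (y a - y o) := by
    rw [map_sub]; abel
  rw [e, mul_assoc]
  exact this

end Gram

/-! ### The lower bound, by embedding in the ambient space. -/

section Transport

variable {n : ℕ} {X Y : Set (EuclideanSpace ℝ (Fin n))}

lemma isoMongeDist_le {p : ℝ} {μ : Measure X} {ν : Measure Y}
    (T : EuclideanSpace ℝ (Fin n) ≃ᵢ EuclideanSpace ℝ (Fin n)) {φ : X → Y}
    (hφ : MeasurePreserving φ μ ν) (hp : 0 ≤ p) :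
    isoMongeDist p μ ν ≤
      (∫⁻ x : X, ‖T (x : EuclideanSpace ℝ (Fin n)) - (φ x : EuclideanSpace ℝ (Fin n))‖ₑ ^ p ∂μ)
        ^ (1 / p) :=
  (iInf_le _ T).trans (ENNReal.rpow_le_rpow (iInf₂_le φ hφ) (by positivity))

/-- An isometry of the ambient space embeds both sets isometrically in the same space. -/
theorem gromovMongeEmb_le_isoMongeDist [PolishSpace X] (μ : Measure X) [IsProbabilityMeasure μ]
    (ν : Measure Y) {p : ℝ} (hp : 0 < p) : gromovMongeEmb p μ ν ≤ isoMongeDist p μ ν := by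
  refine le_iInf fun T => ?_
  obtain ⟨x₀⟩ := nonempty_of_isProbabilityMeasure μ
  -- The root in `isoMongeDist` stands outside the infimum over `φ`, so `p`-th powers are compared.
  have key : ∀ φ : X → Y, MeasurePreserving φ μ ν → gromovMongeEmb p μ ν ^ p ≤
      ∫⁻ x : X, ‖T (x : EuclideanSpace ℝ (Fin n)) - (φ x : EuclideanSpace ℝ (Fin n))‖ₑ ^ p ∂μ := by
    intro φ hφ
    have hf : Isometry fun x : X => T (x : EuclideanSpace ℝ (Fin n)) :=
      T.isometry.comp isometry_subtype_coe
    have hg : Isometry fun y : Y => (y : EuclideanSpace ℝ (Fin n)) := isometry_subtype_coe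
    have hfm : MeasurableEmbedding fun x : X => T (x : EuclideanSpace ℝ (Fin n)) :=
      hf.continuous.measurableEmbedding hf.injective
    let Φ : EuclideanSpace ℝ (Fin n) → EuclideanSpace ℝ (Fin n) :=
      Function.extend (fun x : X => T (x : EuclideanSpace ℝ (Fin n))) (fun x => (φ x : _))
        (fun _ => 0)
    have hΦ : ∀ x : X, Φ (T x) = φ x := fun x => hf.injective.extend_apply _ _ x
    have hΦm : Measurable Φ :=
      hfm.measurable_extend (measurable_subtype_coe.comp hφ.measurable) measurable_const
    have hΦp : MeasurePreserving Φ (μ.map fun x : X => T (x : EuclideanSpace ℝ (Fin n)))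
        (ν.map fun y : Y => (y : EuclideanSpace ℝ (Fin n))) := by
      refine ⟨hΦm, ?_⟩
      rw [Measure.map_map hΦm hfm.measurable, ← hφ.map_eq,
        Measure.map_map measurable_subtype_coe hφ.measurable]
      congr 1
      funext x
      exact hΦ x
    have h1 : gromovMongeEmb p μ ν ≤ mongeDist p
        (μ.map fun x : X => T (x : EuclideanSpace ℝ (Fin n)))
        (ν.map fun y : Y => (y : EuclideanSpace ℝ (Fin n))) :=
      iInf_le_of_le (EuclideanSpace ℝ (Fin n)) <| iInf_le_of_le inferInstance <|
        iInf_le_of_le inferInstance <| iInf_le_of_le inferInstance <| iInf_le_of_le _ <|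
        iInf_le_of_le hf <| iInf_le_of_le _ <| iInf_le_of_le hg le_rfl
    have h2 := h1.trans (iInf₂_le Φ hΦp)
    rw [hfm.lintegral_map] at h2
    simp only [hΦ, edist_eq_enorm_sub] at h2
    rwa [one_div, ENNReal.le_rpow_inv_iff hp] at h2
  rw [one_div, ENNReal.le_rpow_inv_iff hp]
  exact le_iInf₂ key

end Transport

/-! ### Extracting a transport map with controlled distortion. -/

/-- A bound on the Gromov–Monge distance yields a measure-preserving map which distorts distances by
at most `δ x + δ x'`, where the `L^p`-norm of `δ` is controlled. -/
theorem exists_measurePreserving_of_gromovMongeEmb_lt {X : Type u} {Y : Type v}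
    [MetricSpace X] [MeasurableSpace X] [BorelSpace X] [PolishSpace X]
    [MetricSpace Y] [MeasurableSpace Y] [BorelSpace Y] [PolishSpace Y] [Nonempty Y]
    {μ : Measure X} {ν : Measure Y} {p : ℝ} (hp : 0 < p) {e : ℝ≥0∞}
    (h : gromovMongeEmb p μ ν < e) :
    ∃ ψ : X → Y, MeasurePreserving ψ μ ν ∧ ∃ δ : X → ℝ≥0, Measurable δ ∧
      ∫⁻ x, (δ x : ℝ≥0∞) ^ p ∂μ ≤ e ^ p ∧
      ∀ x x', |dist x x' - dist (ψ x) (ψ x')| ≤ δ x + δ x' := by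
  simp only [gromovMongeEmb, mongeDist, iInf_lt_iff] at h
  obtain ⟨Z, _, _, _, f, hf, g, hg, φ, hφ, hlt⟩ := h
  have hfm : MeasurableEmbedding f := hf.continuous.measurableEmbedding hf.injective
  have hgm : MeasurableEmbedding g := hg.continuous.measurableEmbedding hg.injective
  obtain ⟨y₀⟩ := ‹Nonempty Y›
  let G : Z → Y := Function.extend g id fun _ => y₀
  have hG : ∀ y, G (g y) = y := fun y => hg.injective.extend_apply _ _ y
  have hGm : Measurable G := hgm.measurable_extend measurable_id measurable_const
  have hlaw : μ.map (φ ∘ f) = ν.map g := by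
    rw [← Measure.map_map hφ.measurable hfm.measurable, hφ.map_eq]
  have hψ : MeasurePreserving (fun x => G (φ (f x))) μ ν := by
    refine ⟨hGm.comp (hφ.measurable.comp hfm.measurable), ?_⟩
    change μ.map (G ∘ (φ ∘ f)) = ν
    rw [← Measure.map_map hGm (hφ.measurable.comp hfm.measurable), hlaw,
      Measure.map_map hGm hgm.measurable]
    have : G ∘ g = id := funext hG
    rw [this, Measure.map_id]
  -- The law of `φ ∘ f` is carried by the image of `g`, so retracting to `Y` by `G` changes nothing
  -- almost everywhere.
  have hae : ∀ᵐ x ∂μ, g (G (φ (f x))) = φ (f x) := by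
    have h1 : ∀ᵐ z ∂(μ.map (φ ∘ f)), z ∈ Set.range g := by
      rw [hlaw, hgm.ae_map_iff]
      exact Filter.Eventually.of_forall fun y => Set.mem_range_self y
    filter_upwards [ae_of_ae_map (hφ.measurable.comp hfm.measurable).aemeasurable h1] with x hx
    obtain ⟨y, hy⟩ := hx
    rw [Function.comp_apply] at hy
    rw [← hy, hG]
  -- Using the retracted point makes the distortion bound hold everywhere. Measurability is checked
  -- on `X × Y`, since `Z` need not be separable.
  refine ⟨_, hψ, fun x => nndist (f x) (g (G (φ (f x)))), ?_, ?_, fun x x' => ?_⟩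
  · have : Continuous fun q : X × Y => nndist (f q.1) (g q.2) :=
      (hf.continuous.comp continuous_fst).nndist (hg.continuous.comp continuous_snd)
    exact this.measurable.comp (measurable_id.prodMk hψ.measurable)
  · rw [hfm.lintegral_map] at hlt
    have e1 : ∫⁻ x, (nndist (f x) (g (G (φ (f x)))) : ℝ≥0∞) ^ p ∂μ
        = ∫⁻ x, edist (f x) (φ (f x)) ^ p ∂μ := by
      refine lintegral_congr_ae ?_
      filter_upwards [hae] with x hx
      rw [hx, edist_nndist]
    rw [e1]
    rw [one_div] at hlt
    exact ((ENNReal.rpow_inv_lt_iff hp).1 hlt).le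
  · rw [← hf.dist_eq, ← hg.dist_eq, coe_nndist, coe_nndist]
    have h1 := dist_triangle4 (f x) (g (G (φ (f x)))) (g (G (φ (f x')))) (f x')
    have h2 := dist_triangle4 (g (G (φ (f x)))) (f x) (f x') (g (G (φ (f x'))))
    rw [dist_comm (g (G (φ (f x')))) (f x')] at h1
    rw [dist_comm (g (G (φ (f x)))) (f x)] at h2
    rw [abs_le]
    constructor <;> linarith

/-- Markov's inequality for the `p`-th power. -/
lemma measure_lt_le_rpow {X : Type*} [MeasurableSpace X] {μ : Measure X} {δ : X → ℝ≥0}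
    (hδ : Measurable δ) {p : ℝ} (hp : 0 < p) {e t : ℝ} (ht : 0 < t)
    (h : ∫⁻ x, (δ x : ℝ≥0∞) ^ p ∂μ ≤ ENNReal.ofReal e ^ p) :
    μ {x | t < δ x} ≤ ENNReal.ofReal (e / t) ^ p := by
  have ht0 : ENNReal.ofReal t ^ p ≠ 0 := by
    simp [ENNReal.rpow_eq_zero_iff, ht, hp]
  have ht1 : ENNReal.ofReal t ^ p ≠ ∞ := ENNReal.rpow_ne_top_of_nonneg hp.le ENNReal.ofReal_ne_top
  calc μ {x | t < δ x} ≤ μ {x | ENNReal.ofReal t ^ p ≤ (δ x : ℝ≥0∞) ^ p} := by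
        refine measure_mono fun x hx => ?_
        refine ENNReal.rpow_le_rpow ?_ hp.le
        rw [← ENNReal.ofReal_coe_nnreal]
        exact ENNReal.ofReal_le_ofReal hx.le
    _ ≤ (∫⁻ x, (δ x : ℝ≥0∞) ^ p ∂μ) / ENNReal.ofReal t ^ p :=
        meas_ge_le_lintegral_div (hδ.coe_nnreal_ennreal.pow_const p).aemeasurable ht0 ht1
    _ ≤ ENNReal.ofReal e ^ p / ENNReal.ofReal t ^ p := by gcongr
    _ = _ := by rw [ENNReal.ofReal_div_of_pos ht, ENNReal.div_rpow_of_nonneg _ _ hp.le]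

lemma enorm_le_ofReal {E : Type*} [SeminormedAddCommGroup E] {v : E} {r : ℝ} (h : ‖v‖ ≤ r) :
    ‖v‖ₑ ≤ ENNReal.ofReal r := by
  rw [← ofReal_norm]
  exact ENNReal.ofReal_le_ofReal h

/-! ### Quantitative upper bound for bounded sets. -/

section Bounded

variable {n : ℕ} {X Y : Set (EuclideanSpace ℝ (Fin n))} {μ : Measure X} {ν : Measure Y}

/-- Any measure-preserving map between bounded sets bounds the isometry-invariant Monge distance,
since a translation makes the two sets meet. -/
theorem isoMongeDist_le_of_dist_le [IsProbabilityMeasure μ] {p : ℝ} (hp : 0 < p) {ψ : X → Y}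
    (hψ : MeasurePreserving ψ μ ν) {m : ℝ} (hX : ∀ x x' : X, dist x x' ≤ m)
    (hY : ∀ y y' : Y, dist y y' ≤ m) :
    isoMongeDist p μ ν ≤ ENNReal.ofReal (2 * m) := by
  obtain ⟨o⟩ := nonempty_of_isProbabilityMeasure μ
  refine (isoMongeDist_le (IsometryEquiv.addRight
    ((ψ o : EuclideanSpace ℝ (Fin n)) - (o : EuclideanSpace ℝ (Fin n)))) hψ hp.le).trans ?_
  rw [one_div, ENNReal.rpow_inv_le_iff hp]
  calc _ ≤ ∫⁻ _ : X, ENNReal.ofReal (2 * m) ^ p ∂μ := by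
        refine lintegral_mono fun x => ENNReal.rpow_le_rpow (enorm_le_ofReal ?_) hp.le
        have h1 : ‖(x : EuclideanSpace ℝ (Fin n)) - o‖ ≤ m := by
          simpa [Subtype.dist_eq, dist_eq_norm] using hX x o
        have h2 : ‖(ψ o : EuclideanSpace ℝ (Fin n)) - ψ x‖ ≤ m := by
          simpa [Subtype.dist_eq, dist_eq_norm] using hY (ψ o) (ψ x)
        have e : (x : EuclideanSpace ℝ (Fin n)) + ((ψ o : EuclideanSpace ℝ (Fin n)) - o) - ψ x
          = ((x : EuclideanSpace ℝ (Fin n)) - o) + ((ψ o : EuclideanSpace ℝ (Fin n)) - ψ x) := by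
          abel
        rw [IsometryEquiv.addRight_apply, e]
        linarith [norm_add_le ((x : EuclideanSpace ℝ (Fin n)) - o)
          ((ψ o : EuclideanSpace ℝ (Fin n)) - ψ x)]
    _ = _ := by simp

/-- The quantitative estimate between sets of diameter at most `m`. With `s = m ^ (3/4) * e ^ (1/4)`,
the points moved by more than `t = s ^ 2 / m` are few, and the others are matched by an isometry up
to an error of order `√(t * m) = s`. -/
theorem exists_isoMongeDist_le_of_gromovMongeEmb_lt (n : ℕ) :
    ∃ C : ℝ, 0 ≤ C ∧ ∀ (X Y : Set (EuclideanSpace ℝ (Fin n))) [PolishSpace X] [PolishSpace Y]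
      (μ : Measure X) [IsProbabilityMeasure μ] (ν : Measure Y) [IsProbabilityMeasure ν] (p : ℝ),
      1 ≤ p → ∀ m s e : ℝ, 0 < s → s < m → 0 < e → s ^ 4 = m ^ 3 * e →
      (∀ x x' : X, dist x x' ≤ m) → (∀ y y' : Y, dist y y' ≤ m) →
      gromovMongeEmb p μ ν < ENNReal.ofReal e →
      isoMongeDist p μ ν ≤ ENNReal.ofReal (C * s) := by
  obtain ⟨C, hC, H⟩ := exists_affineIsometry_of_nearIsometry (EuclideanSpace ℝ (Fin n))
  refine ⟨2 + 2 * C, by positivity, ?_⟩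
  intro X Y _ _ μ _ ν _ p hp m s e hs hsm he hse hX hY hlt
  have hp0 : 0 < p := by linarith
  have hm : 0 < m := hs.trans hsm
  obtain ⟨y₀⟩ := nonempty_of_isProbabilityMeasure ν
  have : Nonempty Y := ⟨y₀⟩
  obtain ⟨ψ, hψ, δ, hδ, hint, hdist⟩ := exists_measurePreserving_of_gromovMongeEmb_lt hp0 hlt
  set t := s ^ 2 / m with ht
  have ht0 : 0 < t := by positivity
  have hmark := measure_lt_le_rpow hδ hp0 ht0 hint
  have het : e / t = (s / m) ^ 2 := by
    rw [ht]; field_simp; linarith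
  have htm : √(t * m) = s := by
    rw [ht, div_mul_cancel₀ _ hm.ne', Real.sqrt_sq hs.le]
  have hsm1 : s / m < 1 := (div_lt_one hm).2 hsm
  have hsm0 : 0 < s / m := by positivity
  -- The exceptional set has mass below `1`, so some good point anchors the crude bound `hfar` at
  -- all points.
  obtain ⟨a₀, ha₀⟩ : ∃ a₀, (δ a₀ : ℝ) ≤ t := by
    by_contra! hcon
    have huniv : {x | t < δ x} = Set.univ := Set.eq_univ_of_forall hcon
    rw [huniv, measure_univ, het] at hmark
    refine absurd hmark (not_le.2 (ENNReal.rpow_lt_one ?_ hp0))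
    rw [ENNReal.ofReal_lt_one]
    exact pow_lt_one₀ hsm0.le hsm1 two_ne_zero
  obtain ⟨U, w, hU⟩ := H {x : X // (δ x : ℝ) ≤ t} (fun a => (a.1 : EuclideanSpace ℝ (Fin n)))
    (fun a => (ψ a.1 : EuclideanSpace ℝ (Fin n))) t m ht0.le hm.le (fun a b => hX a b)
    (fun a b => hY _ _)
    (fun a b => by
      have := hdist a.1 b.1
      rw [Subtype.dist_eq, Subtype.dist_eq] at this
      linarith [a.2, b.2])
  rw [htm] at hU
  have hfar : ∀ x : X, ‖U (x : EuclideanSpace ℝ (Fin n)) + w - ψ x‖ ≤ (2 + C) * m := fun x => by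
    have h1 : ‖U (x : EuclideanSpace ℝ (Fin n)) - U (a₀ : EuclideanSpace ℝ (Fin n))‖ ≤ m := by
      rw [← map_sub, LinearIsometryEquiv.norm_map, ← dist_eq_norm]
      exact hX x a₀
    have h2 : ‖(ψ a₀ : EuclideanSpace ℝ (Fin n)) - ψ x‖ ≤ m := by
      rw [← dist_eq_norm]; exact hY _ _
    have h3 := hU ⟨a₀, ha₀⟩
    have e : U (x : EuclideanSpace ℝ (Fin n)) + w - ψ x
      = (U (x : EuclideanSpace ℝ (Fin n)) - U (a₀ : EuclideanSpace ℝ (Fin n)))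
        + (U (a₀ : EuclideanSpace ℝ (Fin n)) + w - ψ a₀)
        + ((ψ a₀ : EuclideanSpace ℝ (Fin n)) - ψ x) := by abel
    rw [e]
    refine (norm_add₃_le).trans ?_
    have h4 : C * s ≤ C * m := by gcongr
    linarith
  refine (isoMongeDist_le (U.toIsometryEquiv.trans (IsometryEquiv.addRight w)) hψ hp0.le).trans ?_
  rw [one_div, ENNReal.rpow_inv_le_iff hp0]
  have hmeas : MeasurableSet {x | t < δ x} := measurableSet_lt measurable_const hδ.coe_nnreal_real
  calc _ ≤ ∫⁻ x : X, (ENNReal.ofReal (C * s) ^ p + {x | t < (δ x : ℝ)}.indicator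
          (fun _ => ENNReal.ofReal ((2 + C) * m) ^ p) x) ∂μ := by
        refine lintegral_mono fun x => ?_
        change ‖U (x : EuclideanSpace ℝ (Fin n)) + w - ψ x‖ₑ ^ p ≤ _
        by_cases hx : t < δ x
        · rw [Set.indicator_of_mem (by exact hx)]
          exact le_add_left (ENNReal.rpow_le_rpow (enorm_le_ofReal (hfar x)) hp0.le)
        · exact le_add_right (ENNReal.rpow_le_rpow
            (enorm_le_ofReal (hU ⟨x, not_lt.1 hx⟩)) hp0.le)
    _ = ENNReal.ofReal (C * s) ^ p + ENNReal.ofReal ((2 + C) * m) ^ p * μ {x | t < δ x} := by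
        rw [lintegral_add_left measurable_const, lintegral_indicator hmeas]
        simp
    _ ≤ ENNReal.ofReal (C * s) ^ p
          + ENNReal.ofReal ((2 + C) * m) ^ p * ENNReal.ofReal ((s / m) ^ 2) ^ p := by
        rw [← het]; gcongr
    _ = ENNReal.ofReal (C * s) ^ p + ENNReal.ofReal ((2 + C) * m * (s / m) ^ 2) ^ p := by
        rw [← ENNReal.mul_rpow_of_nonneg _ _ hp0.le, ← ENNReal.ofReal_mul (by positivity)]
    _ ≤ ENNReal.ofReal (C * s) ^ p + ENNReal.ofReal ((2 + C) * s) ^ p := by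
        refine add_le_add le_rfl (ENNReal.rpow_le_rpow (ENNReal.ofReal_le_ofReal ?_) hp0.le)
        -- Exceptional points cost `s` times the spare factor `s / m < 1`.
        have : (2 + C) * m * (s / m) ^ 2 = (2 + C) * s * (s / m) := by field_simp
        rw [this]
        exact mul_le_of_le_one_right (by positivity) hsm1.le
    _ ≤ (ENNReal.ofReal (C * s) + ENNReal.ofReal ((2 + C) * s)) ^ p :=
        ENNReal.add_rpow_le_rpow_add _ _ hp
    _ = _ := by
        rw [← ENNReal.ofReal_add (by positivity) (by positivity)]
        congr 2; ring

end Bounded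

/-! ### Vanishing distance, without boundedness. -/

section Limit

open Filter Topology

variable {n : ℕ} {X Y : Set (EuclideanSpace ℝ (Fin n))} {μ : Measure X} {ν : Measure Y}

lemma exists_measure_norm_gt_le (μ : Measure X) [IsFiniteMeasure μ] {ε : ℝ≥0∞} (hε : 0 < ε) :
    ∃ R : ℝ, 0 < R ∧ μ {x | R < ‖(x : EuclideanSpace ℝ (Fin n))‖} ≤ ε := by
  have h := tendsto_measure_iInter_atTop (μ := μ)
    (s := fun k : ℕ => {x : X | (k : ℝ) < ‖(x : EuclideanSpace ℝ (Fin n))‖})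
    (fun k => (measurableSet_lt measurable_const
      measurable_subtype_coe.norm).nullMeasurableSet)
    (fun i j hij x hx => by
      have hij' : (i : ℝ) ≤ j := Nat.cast_le.2 hij
      exact hij'.trans_lt hx) ⟨0, measure_ne_top _ _⟩
  have hempty : ⋂ k : ℕ, {x : X | (k : ℝ) < ‖(x : EuclideanSpace ℝ (Fin n))‖} = ∅ := by
    refine Set.eq_empty_of_forall_notMem fun x hx => ?_
    obtain ⟨k, hk⟩ := exists_nat_ge ‖(x : EuclideanSpace ℝ (Fin n))‖
    exact absurd (Set.mem_iInter.1 hx k) (not_lt.2 hk)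
  rw [hempty, measure_empty] at h
  obtain ⟨k, hk, hk1⟩ := ((h.eventually (gt_mem_nhds hε)).and (eventually_gt_atTop 0)).exists
  exact ⟨k, Nat.cast_pos.2 hk1, hk.le⟩

lemma exists_pos_mul_sqrt_le (C L : ℝ) {ε : ℝ} (hε : 0 < ε) :
    ∃ t : ℝ, 0 < t ∧ t ≤ 1 ∧ C * √(t * L) ≤ ε := by
  have hcont : Continuous fun t : ℝ => C * √(t * L) := by fun_prop
  have h0 := hcont.tendsto 0
  simp only [zero_mul, Real.sqrt_zero, mul_zero] at h0
  have h1 := (h0.mono_left (nhdsWithin_le_nhds (s := Set.Ioi 0))).eventually (gt_mem_nhds hε)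
  obtain ⟨t, ht, htIoc⟩ := (h1.and (Ioc_mem_nhdsGT (zero_lt_one' ℝ))).exists
  exact ⟨t, htIoc.1, htIoc.2, ht.le⟩

/-- If the Gromov–Monge distance vanishes, then there are isometries close in measure to
measure-preserving maps, even for unbounded sets. -/
lemma exists_isometry_close_in_measure [PolishSpace X] [PolishSpace Y]
    [IsProbabilityMeasure μ] [IsProbabilityMeasure ν] {p : ℝ} (hp : 1 ≤ p)
    (h : gromovMongeEmb p μ ν = 0) {ε : ℝ} (hε : 0 < ε) (hε1 : ε ≤ 1) :
    ∃ (U : EuclideanSpace ℝ (Fin n) ≃ₗᵢ[ℝ] EuclideanSpace ℝ (Fin n))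
      (w : EuclideanSpace ℝ (Fin n)) (ψ : X → Y), MeasurePreserving ψ μ ν ∧
      μ {x : X | ε < ‖U (x : EuclideanSpace ℝ (Fin n)) + w - ψ x‖} ≤ ENNReal.ofReal ε := by
  obtain ⟨C, hC, H⟩ := exists_affineIsometry_of_nearIsometry (EuclideanSpace ℝ (Fin n))
  have hp0 : 0 < p := by linarith
  obtain ⟨y₀⟩ := nonempty_of_isProbabilityMeasure ν
  have : Nonempty Y := ⟨y₀⟩
  obtain ⟨R, hR, hμR⟩ := exists_measure_norm_gt_le μ (ε := ENNReal.ofReal (ε / 2)) (by simpa)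
  -- Good points in the ball of radius `R` are at most `2 * R` apart, and their images at most `2 *
  -- R + 2 * t ≤ 2 * R + 2`.
  obtain ⟨t, ht0, ht1, htC⟩ := exists_pos_mul_sqrt_le C (2 * R + 2) hε
  obtain ⟨ψ, hψ, δ, hδ, hint, hdist⟩ := exists_measurePreserving_of_gromovMongeEmb_lt hp0
    (h.trans_lt (show (0 : ℝ≥0∞) < ENNReal.ofReal (t * (ε / 2)) by
      rw [ENNReal.ofReal_pos]; positivity))
  have hmark := measure_lt_le_rpow hδ hp0 ht0 hint
  rw [mul_div_cancel_left₀ _ ht0.ne'] at hmark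
  have hmark' : μ {x | t < δ x} ≤ ENNReal.ofReal (ε / 2) := by
    refine hmark.trans ((ENNReal.rpow_le_rpow_of_exponent_ge ?_ hp).trans_eq (ENNReal.rpow_one _))
    rw [ENNReal.ofReal_le_one]; linarith
  have hXd : ∀ a b : {x : X // (δ x : ℝ) ≤ t ∧ ‖(x : EuclideanSpace ℝ (Fin n))‖ ≤ R},
      dist (a.1 : EuclideanSpace ℝ (Fin n)) b.1 ≤ 2 * R := fun a b => by
    rw [dist_eq_norm]
    linarith [norm_sub_le (a.1 : EuclideanSpace ℝ (Fin n)) b.1, a.2.2, b.2.2]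
  have hXY : ∀ a b : {x : X // (δ x : ℝ) ≤ t ∧ ‖(x : EuclideanSpace ℝ (Fin n))‖ ≤ R},
      |dist (a.1 : EuclideanSpace ℝ (Fin n)) b.1
        - dist (ψ a.1 : EuclideanSpace ℝ (Fin n)) (ψ b.1)| ≤ 2 * t := fun a b => by
    have := hdist a.1 b.1
    rw [Subtype.dist_eq, Subtype.dist_eq] at this
    linarith [a.2.1, b.2.1]
  obtain ⟨U, w, hU⟩ := H {x : X // (δ x : ℝ) ≤ t ∧ ‖(x : EuclideanSpace ℝ (Fin n))‖ ≤ R}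
    (fun a => (a.1 : EuclideanSpace ℝ (Fin n)))
    (fun a => (ψ a.1 : EuclideanSpace ℝ (Fin n))) t (2 * R + 2) ht0.le (by positivity)
    (fun a b => by linarith [hXd a b])
    (fun a b => by linarith [hXd a b, (abs_le.1 (hXY a b)).1]) hXY
  refine ⟨U, w, ψ, hψ, ?_⟩
  have hsub : {x : X | ε < ‖U (x : EuclideanSpace ℝ (Fin n)) + w - ψ x‖}
      ⊆ {x | t < δ x} ∪ {x | R < ‖(x : EuclideanSpace ℝ (Fin n))‖} := fun x hx => by
    by_contra hcon
    simp only [Set.mem_union, Set.mem_ofPred_eq, not_or, not_lt] at hcon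
    exact absurd ((hU ⟨x, hcon⟩).trans htC) (not_le.2 hx)
  calc _ ≤ _ := measure_mono hsub
    _ ≤ ENNReal.ofReal (ε / 2) + ENNReal.ofReal (ε / 2) :=
        (measure_union_le _ _).trans (add_le_add hmark' hμR)
    _ = _ := by rw [← ENNReal.ofReal_add (by positivity) (by positivity), add_halves]

/-- If the Gromov–Monge distance vanishes, then an isometry of the ambient space transports one
measure to the other. -/
theorem exists_isometryEquiv_map_eq [PolishSpace X] [PolishSpace Y]
    [IsProbabilityMeasure μ] [IsProbabilityMeasure ν] {p : ℝ} (hp : 1 ≤ p)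
    (h : gromovMongeEmb p μ ν = 0) :
    ∃ T : EuclideanSpace ℝ (Fin n) ≃ᵢ EuclideanSpace ℝ (Fin n),
      μ.map (fun x : X => T x) = ν.map ((↑) : Y → EuclideanSpace ℝ (Fin n)) := by
  -- These tolerances are summable, for Borel–Cantelli, and at most `1 / 4`, so that three bad
  -- events of such mass leave a good point.
  have hε : ∀ k : ℕ, (0 : ℝ) < (1 / 2) ^ (k + 2) := fun k => by positivity
  have hε4 : ∀ k : ℕ, ((1 : ℝ) / 2) ^ (k + 2) ≤ 1 / 4 := fun k => by
    rw [pow_add]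
    have : ((1 : ℝ) / 2) ^ k ≤ 1 := pow_le_one₀ (by norm_num) (by norm_num)
    linarith
  choose U w ψ hψ hbad using fun k =>
    exists_isometry_close_in_measure hp h (hε k) ((hε4 k).trans (by norm_num))
  obtain ⟨R, hR, hμR⟩ := exists_measure_norm_gt_le μ (ε := ENNReal.ofReal (1 / 4)) (by simp)
  obtain ⟨R', hR', hνR⟩ := exists_measure_norm_gt_le ν (ε := ENNReal.ofReal (1 / 4)) (by simp)
  -- One point where `x` and `ψ k x` are bounded and the motion is accurate bounds the translation,
  -- giving compactness of the motions.
  have hw : ∀ k, ‖w k‖ ≤ 1 + R + R' := fun k => by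
    have hνR' : μ {x | R' < ‖(ψ k x : EuclideanSpace ℝ (Fin n))‖} ≤ ENNReal.ofReal (1 / 4) := by
      rw [← (hψ k).measure_preimage (measurableSet_lt measurable_const
        measurable_subtype_coe.norm).nullMeasurableSet] at hνR
      exact hνR
    obtain ⟨x, hx⟩ : ∃ x : X, x ∉ {x : X | R < ‖(x : EuclideanSpace ℝ (Fin n))‖}
        ∪ {x | R' < ‖(ψ k x : EuclideanSpace ℝ (Fin n))‖}
        ∪ {x : X | (1 / 2) ^ (k + 2) < ‖U k (x : EuclideanSpace ℝ (Fin n)) + w k - ψ k x‖} := by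
      by_contra! hcon
      have h1 := measure_univ (μ := μ)
      rw [← Set.eq_univ_of_forall hcon] at h1
      have h2 : (1 : ℝ≥0∞) ≤ ENNReal.ofReal (1 / 4) + ENNReal.ofReal (1 / 4)
          + ENNReal.ofReal (1 / 4) := by
        rw [← h1]
        refine (measure_union_le _ _).trans (add_le_add ((measure_union_le _ _).trans
          (add_le_add hμR hνR')) ((hbad k).trans (ENNReal.ofReal_le_ofReal (hε4 k))))
      rw [← ENNReal.ofReal_add (by norm_num) (by norm_num),
        ← ENNReal.ofReal_add (by norm_num) (by norm_num), ENNReal.one_le_ofReal] at h2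
      norm_num at h2
    simp only [Set.mem_union, Set.mem_ofPred_eq, not_or, not_lt] at hx
    have e : w k = (U k (x : EuclideanSpace ℝ (Fin n)) + w k - ψ k x)
      - U k (x : EuclideanSpace ℝ (Fin n)) + ψ k x := by abel
    rw [e]
    have h1 := norm_add_le ((U k (x : EuclideanSpace ℝ (Fin n)) + w k - ψ k x)
      - U k (x : EuclideanSpace ℝ (Fin n))) (ψ k x)
    have h2 := norm_sub_le (U k (x : EuclideanSpace ℝ (Fin n)) + w k - ψ k x)
      (U k (x : EuclideanSpace ℝ (Fin n)))
    rw [LinearIsometryEquiv.norm_map] at h2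
    linarith [hx.1.1, hx.1.2, hx.2, hε4 k]
  let q : ℕ → (EuclideanSpace ℝ (Fin n) →L[ℝ] EuclideanSpace ℝ (Fin n)) ×
      EuclideanSpace ℝ (Fin n) := fun k =>
    ((U k).toLinearIsometry.toContinuousLinearMap, w k)
  have hq : ∀ k, q k ∈ Metric.closedBall (0 : (EuclideanSpace ℝ (Fin n) →L[ℝ]
      EuclideanSpace ℝ (Fin n)) × EuclideanSpace ℝ (Fin n)) (1 + R + R') := fun k => by
    rw [mem_closedBall_zero_iff, Prod.norm_def]
    refine max_le (((U k).toLinearIsometry.norm_toContinuousLinearMap_le).trans ?_) (hw k)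
    linarith
  have : ProperSpace (EuclideanSpace ℝ (Fin n) →L[ℝ] EuclideanSpace ℝ (Fin n)) :=
    FiniteDimensional.proper ℝ _
  obtain ⟨⟨A, b⟩, -, σ, hσ, hlim⟩ := tendsto_subseq_of_bounded Metric.isBounded_closedBall hq
  have hA : ∀ x, Tendsto (fun k => U (σ k) x) atTop (𝓝 (A x)) := fun x =>
    ((ContinuousLinearMap.apply ℝ _ x).continuous.tendsto _).comp
      ((continuous_fst.tendsto _).comp hlim)
  have hb : Tendsto (fun k => w (σ k)) atTop (𝓝 b) := (continuous_snd.tendsto _).comp hlim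
  have hnorm : ∀ x, ‖A x‖ = ‖x‖ := fun x =>
    tendsto_nhds_unique (hA x).norm (by simp)
  let L : EuclideanSpace ℝ (Fin n) →ₗᵢ[ℝ] EuclideanSpace ℝ (Fin n) := ⟨A.toLinearMap, hnorm⟩
  refine ⟨(L.toLinearIsometryEquiv rfl).toIsometryEquiv.trans (IsometryEquiv.addRight b), ?_⟩
  change μ.map (fun x : X => A x + b) = _
  have hae : ∀ᵐ x : X ∂μ, Tendsto (fun k => (ψ (σ k) x : EuclideanSpace ℝ (Fin n))) atTop
      (𝓝 (A x + b)) := by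
    have hsum : ∑' k, μ {x : X | (1 / 2) ^ (k + 2)
        < ‖U k (x : EuclideanSpace ℝ (Fin n)) + w k - ψ k x‖} ≠ ∞ := by
      refine ne_top_of_le_ne_top ?_ (ENNReal.tsum_le_tsum hbad)
      have hs : Summable fun k : ℕ => ((1 : ℝ) / 2) ^ (k + 2) :=
        (summable_nat_add_iff 2).2 summable_geometric_two
      exact hs.tsum_ofReal_ne_top
    filter_upwards [ae_eventually_notMem hsum] with x hx
    have h1 : Tendsto (fun k => U k (x : EuclideanSpace ℝ (Fin n)) + w k - ψ k x) atTop (𝓝 0) := by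
      refine squeeze_zero_norm' (a := fun k => ((1 : ℝ) / 2) ^ (k + 2)) ?_ ?_
      · filter_upwards [hx] with k hk
        exact not_lt.1 hk
      · exact (tendsto_add_atTop_iff_nat 2).2
          (tendsto_pow_atTop_nhds_zero_of_lt_one (by norm_num) (by norm_num))
    have h2 := ((hA x).add hb).sub (h1.comp hσ.tendsto_atTop)
    simpa using h2
  have hAm : Measurable fun x : X => A x + b :=
    (A.continuous.measurable.comp measurable_subtype_coe).add_const b
  refine ext_of_forall_lintegral_eq_of_IsFiniteMeasure fun f => ?_
  have hfm : Measurable fun z => (f z : ℝ≥0∞) := f.continuous.measurable.coe_nnreal_ennreal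
  -- Each `ψ (σ k)` has law `ν`, so the integrals of a bounded continuous test function are constant
  -- in `k`; dominated convergence identifies the limit law.
  rw [lintegral_map hfm hAm, lintegral_map hfm measurable_subtype_coe]
  have hconst : ∀ k, ∫⁻ x, (f (ψ (σ k) x) : ℝ≥0∞) ∂μ = ∫⁻ y : Y, (f y : ℝ≥0∞) ∂ν := fun k =>
    (hψ (σ k)).lintegral_comp (hfm.comp measurable_subtype_coe)
  have hdom := tendsto_lintegral_of_dominated_convergence (μ := μ)
    (F := fun k x => (f (ψ (σ k) x) : ℝ≥0∞)) (f := fun x => (f (A x + b) : ℝ≥0∞))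
    (fun _ => (nndist f 0 : ℝ≥0∞))
    (fun k => hfm.comp (measurable_subtype_coe.comp (hψ (σ k)).measurable))
    (fun k => .of_forall fun x => ENNReal.coe_le_coe.2 (BoundedContinuousFunction.NNReal.upper_bound f _))
    (by simp)
    (by
      filter_upwards [hae] with x hx
      exact ((ENNReal.continuous_coe.comp f.continuous).tendsto _).comp hx)
  simp only [hconst] at hdom
  exact tendsto_nhds_unique hdom tendsto_const_nhds

/-- An isometry which transports one measure to the other restricts, up to a null set, to a
measure-preserving map between the two sets. -/
theorem isoMongeDist_eq_zero_of_map_eq [PolishSpace Y] [IsProbabilityMeasure ν] {p : ℝ} (hp : 0 < p)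
    (T : EuclideanSpace ℝ (Fin n) ≃ᵢ EuclideanSpace ℝ (Fin n))
    (hT : μ.map (fun x : X => T x) = ν.map ((↑) : Y → EuclideanSpace ℝ (Fin n))) :
    isoMongeDist p μ ν = 0 := by
  obtain ⟨y₀⟩ := nonempty_of_isProbabilityMeasure ν
  have hYm : MeasurableEmbedding ((↑) : Y → EuclideanSpace ℝ (Fin n)) :=
    continuous_subtype_val.measurableEmbedding Subtype.val_injective
  have hTm : Measurable fun x : X => T x := T.continuous.measurable.comp measurable_subtype_coe
  let G : EuclideanSpace ℝ (Fin n) → Y := Function.extend (↑) id fun _ => y₀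
  have hG : ∀ y : Y, G y = y := fun y => Subtype.val_injective.extend_apply _ _ y
  have hGm : Measurable G := hYm.measurable_extend measurable_id measurable_const
  have hφ : MeasurePreserving (fun x : X => G (T x)) μ ν := by
    refine ⟨hGm.comp hTm, ?_⟩
    change μ.map (G ∘ fun x : X => T x) = ν
    rw [← Measure.map_map hGm hTm, hT, Measure.map_map hGm hYm.measurable]
    have : G ∘ ((↑) : Y → EuclideanSpace ℝ (Fin n)) = id := funext hG
    rw [this, Measure.map_id]
  have hae : ∀ᵐ x : X ∂μ, (G (T x) : EuclideanSpace ℝ (Fin n)) = T x := by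
    refine ae_of_ae_map (p := fun z => (G z : EuclideanSpace ℝ (Fin n)) = z) hTm.aemeasurable ?_
    rw [hT, hYm.ae_map_iff]
    exact .of_forall fun y => by rw [hG]
  refine le_antisymm ((isoMongeDist_le T hφ hp.le).trans ?_) bot_le
  have h0 : ∫⁻ x : X, ‖T x - (G (T x) : EuclideanSpace ℝ (Fin n))‖ₑ ^ p ∂μ = 0 := by
    rw [← lintegral_zero (μ := μ)]
    refine lintegral_congr_ae ?_
    filter_upwards [hae] with x hx
    rw [hx]; simp [hp]
  rw [h0]; simp [hp]

end Limit

/-! ### Assembly of the theorem and its degenerate cases. -/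

lemma ofReal_rpow_quarter_mul {m e : ℝ} (hm : 0 ≤ m) (he : 0 ≤ e) :
    ENNReal.ofReal (m ^ (3 / 4 : ℝ) * e ^ (1 / 4 : ℝ))
      = ENNReal.ofReal m ^ (3 / 4 : ℝ) * ENNReal.ofReal e ^ (1 / 4 : ℝ) := by
  rw [ENNReal.ofReal_mul (by positivity), ENNReal.ofReal_rpow_of_nonneg hm (by norm_num),
    ENNReal.ofReal_rpow_of_nonneg he (by norm_num)]

theorem theorem4p5 (n : ℕ) :
    ∃ c : ℝ≥0, ∀ (X Y : Set (EuclideanSpace ℝ (Fin n))) [PolishSpace X] [PolishSpace Y]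
      (μ : Measure X) [IsProbabilityMeasure μ] [μ.IsOpenPosMeasure]
      (ν : Measure Y) [IsProbabilityMeasure ν] [ν.IsOpenPosMeasure] (p : ℝ), 1 ≤ p →
      gromovMongeEmb p μ ν ≤ isoMongeDist p μ ν ∧
      isoMongeDist p μ ν ≤
        max (Metric.ediam X) (Metric.ediam Y) ^ (3 / 4 : ℝ) * (c : ℝ≥0∞) *
          gromovMongeEmb p μ ν ^ (1 / 4 : ℝ) := by
  obtain ⟨C, hC, H⟩ := exists_isoMongeDist_le_of_gromovMongeEmb_lt n
  refine ⟨(C + 2).toNNReal, ?_⟩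
  intro X Y _ _ μ _ _ ν _ _ p hp
  have hp0 : 0 < p := by linarith
  refine ⟨gromovMongeEmb_le_isoMongeDist μ ν hp0, ?_⟩
  have hc0 : ((C + 2).toNNReal : ℝ≥0∞) ≠ 0 := by
    rw [ENNReal.coe_ne_zero, ne_eq, Real.toNNReal_eq_zero]; linarith
  -- This case comes before `M = ∞`: there the right side is `∞ * 0 = 0`.
  rcases eq_or_ne (gromovMongeEmb p μ ν) 0 with hD0 | hD0
  · obtain ⟨T, hT⟩ := exists_isometryEquiv_map_eq hp hD0
    rw [isoMongeDist_eq_zero_of_map_eq hp0 T hT]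
    exact bot_le
  have hD0' : gromovMongeEmb p μ ν ^ (1 / 4 : ℝ) ≠ 0 := by
    simp [ENNReal.rpow_eq_zero_iff, hD0]
  set M := max (Metric.ediam X) (Metric.ediam Y) with hM
  rcases eq_or_ne M ∞ with hMtop | hMtop
  · rw [hMtop, ENNReal.top_rpow_of_pos (by norm_num), ENNReal.top_mul hc0, ENNReal.top_mul hD0']
    exact le_top
  obtain ⟨m, hm0, hMm⟩ : ∃ m : ℝ, 0 ≤ m ∧ M = ENNReal.ofReal m :=
    ⟨M.toReal, ENNReal.toReal_nonneg, (ENNReal.ofReal_toReal hMtop).symm⟩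
  have hX : ∀ x x' : X, dist x x' ≤ m := fun x x' => by
    have h1 : edist (x : EuclideanSpace ℝ (Fin n)) x' ≤ ENNReal.ofReal m :=
      hMm ▸ (Metric.edist_le_ediam_of_mem x.2 x'.2).trans (le_max_left _ _)
    rwa [edist_le_ofReal hm0] at h1
  have hY : ∀ y y' : Y, dist y y' ≤ m := fun x x' => by
    have h1 : edist (x : EuclideanSpace ℝ (Fin n)) x' ≤ ENNReal.ofReal m :=
      hMm ▸ (Metric.edist_le_ediam_of_mem x.2 x'.2).trans (le_max_right _ _)
    rwa [edist_le_ofReal hm0] at h1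
  obtain ⟨y₀⟩ := nonempty_of_isProbabilityMeasure ν
  rcases hm0.eq_or_lt with hm | hm
  · subst hm
    have : Subsingleton Y := ⟨fun y y' => dist_le_zero.1 (hY y y')⟩
    have hψ : MeasurePreserving (fun _ : X => y₀) μ ν := by
      refine ⟨measurable_const, Measure.ext fun s _ => ?_⟩
      rcases s.eq_empty_or_nonempty with rfl | hs
      · simp
      · rw [Subsingleton.eq_univ_of_nonempty hs]
        simp
    have := isoMongeDist_le_of_dist_le hp0 hψ hX hY
    simp only [mul_zero, ENNReal.ofReal_zero, nonpos_iff_eq_zero] at this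
    rw [this]
    exact bot_le
  rcases eq_or_ne (gromovMongeEmb p μ ν) ∞ with hDtop | hDtop
  · rw [hDtop, ENNReal.top_rpow_of_pos (by norm_num), ENNReal.mul_top]
    · exact le_top
    · exact mul_ne_zero (by rw [hMm]; simp [ENNReal.rpow_eq_zero_iff, hm]) hc0
  have hK : M ^ (3 / 4 : ℝ) * ((C + 2).toNNReal : ℝ≥0∞) ≠ ∞ :=
    ENNReal.mul_ne_top (ENNReal.rpow_ne_top_of_nonneg (by norm_num) hMtop) ENNReal.coe_ne_top
  have hcont : Continuous fun d : ℝ≥0∞ =>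
      M ^ (3 / 4 : ℝ) * ((C + 2).toNNReal : ℝ≥0∞) * d ^ (1 / 4 : ℝ) :=
    (ENNReal.continuous_const_mul hK).comp ENNReal.continuous_rpow_const
  -- The estimates need a strict bound `d` on the distance; continuity then lets `d` decrease to it.
  suffices hstep : ∀ d, gromovMongeEmb p μ ν < d → d ≠ ∞ → isoMongeDist p μ ν ≤
      M ^ (3 / 4 : ℝ) * ((C + 2).toNNReal : ℝ≥0∞) * d ^ (1 / 4 : ℝ) by
    have hne : (nhdsWithin (gromovMongeEmb p μ ν) (Set.Ioi (gromovMongeEmb p μ ν))).NeBot :=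
      nhdsGT_neBot_of_exists_gt ⟨∞, hDtop.lt_top⟩
    refine ge_of_tendsto ((hcont.tendsto _).mono_left
      (nhdsWithin_le_nhds (s := Set.Ioi (gromovMongeEmb p μ ν)))) ?_
    filter_upwards [Ioo_mem_nhdsGT hDtop.lt_top] with d hd
    exact hstep d hd.1 hd.2.ne
  intro d hd hdtop
  obtain ⟨e, he0, hde⟩ : ∃ e : ℝ, 0 ≤ e ∧ d = ENNReal.ofReal e :=
    ⟨d.toReal, ENNReal.toReal_nonneg, (ENNReal.ofReal_toReal hdtop).symm⟩
  rw [hde] at hd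
  have he : 0 < e := ENNReal.ofReal_pos.1 (bot_le.trans_lt hd)
  set s := m ^ (3 / 4 : ℝ) * e ^ (1 / 4 : ℝ) with hs
  have hs0 : 0 < s := by positivity
  have htarget : M ^ (3 / 4 : ℝ) * ((C + 2).toNNReal : ℝ≥0∞) * d ^ (1 / 4 : ℝ)
      = ENNReal.ofReal ((C + 2) * s) := by
    rw [ENNReal.ofReal_mul (by positivity), hs, ofReal_rpow_quarter_mul hm.le he.le, hMm, hde,
      show ((C + 2).toNNReal : ℝ≥0∞) = ENNReal.ofReal (C + 2) from rfl]
    ring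
  rw [htarget]
  have hs4 : s ^ 4 = m ^ 3 * e := by
    rw [hs, mul_pow, ← Real.rpow_mul_natCast hm.le, ← Real.rpow_mul_natCast he.le]
    norm_num
  -- For `s ≥ m` the crude bound `2 * m ≤ 2 * s` suffices, which explains the summand `2` in the
  -- constant.
  rcases lt_or_ge s m with hsm | hsm
  · refine (H X Y μ ν p hp m s e hs0 hsm he hs4 hX hY hd).trans (ENNReal.ofReal_le_ofReal ?_)
    linarith
  · have : Nonempty Y := ⟨y₀⟩
    obtain ⟨ψ, hψ, -⟩ := exists_measurePreserving_of_gromovMongeEmb_lt hp0 hd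
    refine (isoMongeDist_le_of_dist_le hp0 hψ hX hY).trans (ENNReal.ofReal_le_ofReal ?_)
    have : 0 ≤ C * s := by positivity
    linarith
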